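/- For $k\ge 0$ write $(x;q)_k=(1-x)(1-xq)\cdots(1-xq^{k-1})$ (so $(x;q)_0=1$), $(x_1,\dots,x_m;q)_k=(x_1;q)_k\cdots(x_m;q)_k$ and $[n]=1+q+\cdots+q^{n-1}$, and let $\Phi_n(q)$ be the $n$-th cyclotomic polynomial. For rational functions $A,B$ with rational coefficients and a nonzero polynomial $M$ (in the indeterminate $q$, or in the indeterminates $a,q$), $A\equiv B\pmod M$ means that $A-B=MU/V$ with polynomials $U$, $V\neq 0$ such that $V$ and $M$ have no nonconstant common factor. Let $n$ be a positive odd integer. (i) If $n>1$ and $c_q(k)=(-1)^k[3k+1]\dfrac{(q;q^2)_k^3}{(q;q)_k^3}$ for $k\ge 0$, then $$\sum_{k=0}^{n-1}\sum_{j=0}^{k}c_q(j)c_q(k-j)\equiv q^{(n+1)/2}[n]^2\pmod{[n]\Phi_n(q)^2}.$$ (ii) If $c_q(k)=(-1)^k[3k+1]\dfrac{(aq,q/a,q;q^2)_k}{(aq,q/a,q;q)_k}$ for $k\ge 0$, with a further indeterminate $a$, then $$\sum_{k=0}^{n-1}\sum_{j=0}^{k}c_q(j)c_q(k-j)\equiv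 q^{(n-1)^2/2}[n]^2\pmod{[n](1-aq^n)(a-q^n)}.$$ -/

import Mathlib

/-- The `q`-shifted factorial `(x; q)_k = (1 - x)(1 - x q) ⋯ (1 - x q^(k-1))`. -/
def qShifted {K : Type*} [CommRing K] (x q : K) (k : ℕ) : K :=
  ∏ i ∈ Finset.range k, (1 - x * q ^ i)

/-- The `q`-integer `[n] = 1 + q + ⋯ + q^(n-1)`. -/
def qInteger {K : Type*} [CommRing K] (q : K) (n : ℕ) : K :=
  ∑ i ∈ Finset.range n, q ^ i

/-- `c_q(k) = (-1)^k [3k+1] (q;q^2)_k^3 / (q;q)_k^3`. -/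
def cTerm {K : Type*} [Field K] (q : K) (k : ℕ) : K :=
  (-1) ^ k * qInteger q (3 * k + 1) * (qShifted q (q ^ 2) k ^ 3 / qShifted q q k ^ 3)

/-- `(-1)^k [3k+1] (aq, q/a, q; q^2)_k / (aq, q/a, q; q)_k`. -/
def cTermParam {K : Type*} [Field K] (a q : K) (k : ℕ) : K :=
  (-1) ^ k * qInteger q (3 * k + 1) *
    ((qShifted (a * q) (q ^ 2) k * qShifted (q / a) (q ^ 2) k * qShifted q (q ^ 2) k) /
      (qShifted (a * q) q k * qShifted (q / a) q k * qShifted q q k))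

/-- The truncated square `∑_{k=0}^{n-1} ∑_{j=0}^{k} c(j) c(k-j)`. -/
def truncSquare {K : Type*} [CommRing K] (c : ℕ → K) (n : ℕ) : K :=
  ∑ k ∈ Finset.range n, ∑ j ∈ Finset.range (k + 1), c j * c (k - j)

/-- Congruence of fractions modulo an element `m` of the ring `R`, for `K` the fraction field
of `R`: the difference is `m u / v` with `u v : R` and `v` without common factor with `m`. -/
def FracCongr {R K : Type*} [CommRing R] [Field K] [Algebra R K] (m : R) (x y : K) : Prop :=
  ∃ u v : R, v ≠ 0 ∧ IsRelPrime v m ∧ x - y = algebraMap R K (m * u) / algebraMap R K v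

/-- The ring of polynomials in two indeterminates `q` (inner) and `a` (outer). -/
abbrev PolyQA : Type := Polynomial (Polynomial ℚ)

/-- The indeterminate `q` of `PolyQA`. -/
noncomputable def varQ : PolyQA := Polynomial.C Polynomial.X

/-- The indeterminate `a` of `PolyQA`. -/
noncomputable def varA : PolyQA := Polynomial.X

/-- The field of rational functions in `q` and `a`. -/
abbrev RatQA : Type := FractionRing PolyQA

/-!
Up to index `n`, the truncated square of a sequence vanishing on `[(n+1)/2, n)` is the square of its
sum, and by periodicity the same holds, blockwise and up to constants, at roots of unity of odd
order dividing `n`. The sum itself is evaluated at `a = q ^ n` by a contiguity relation in `a`;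
since `c_q(k)` is invariant under `a ↦ a⁻¹`, this settles part (ii) modulo `a - q ^ n` and
`1 - a q ^ n`. At a primitive `d`-th root of unity with `1 < d ∣ n` the sum vanishes, which
settles it modulo each factor `Φ_d(q)` of `[n]`.

Part (i) is treated modulo `Φ_d(q)` for `d ∣ n` in the same way with `a = 1`. Modulo `Φ_n(q) ^ 3` it
is the limit `a → 1` of part (ii), because the denominators stay prime to `Φ_n(q)` and both
factors `1 - a q ^ n` and `a - q ^ n` become divisible by `Φ_n(q)`; the exponents of `q` in the two
parts differ by a multiple of `n`.
-/

section QShifted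

variable {R F : Type*} [CommRing R] [Field F]

theorem qShifted_zero (x q : R) : qShifted x q 0 = 1 :=
  Finset.prod_range_zero _

theorem qShifted_succ (x q : R) (k : ℕ) :
    qShifted x q (k + 1) = qShifted x q k * (1 - x * q ^ k) :=
  Finset.prod_range_succ _ k

theorem qShifted_add (x q : R) (j k : ℕ) :
    qShifted x q (j + k) = qShifted x q j * qShifted (x * q ^ j) q k := by
  simp only [qShifted, Finset.prod_range_add, pow_add, mul_assoc]

theorem qShifted_ne_zero {x q : F} {k : ℕ} (h : ∀ i < k, x * q ^ i ≠ 1) : qShifted x q k ≠ 0 :=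
  Finset.prod_ne_zero_iff.2 fun i hi => sub_ne_zero.2 (h i (Finset.mem_range.1 hi)).symm

theorem qShifted_eq_zero {x q : R} {i k : ℕ} (hik : i < k) (h : x * q ^ i = 1) :
    qShifted x q k = 0 :=
  Finset.prod_eq_zero (Finset.mem_range.2 hik) (by rw [h, sub_self])

theorem qInteger_mul_one_sub (q : R) (n : ℕ) : qInteger q n * (1 - q) = 1 - q ^ n :=
  geom_sum_mul_neg q n

theorem map_qInteger {S : Type*} [CommRing S] (f : R →+* S) (q : R) (n : ℕ) :
    f (qInteger q n) = qInteger (f q) n := by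
  simp only [qInteger, map_sum, map_pow]

theorem qInteger_eq_div {q : F} (hq : q ≠ 1) (n : ℕ) : qInteger q n = (1 - q ^ n) / (1 - q) :=
  eq_div_of_mul_eq (sub_ne_zero.2 hq.symm) (qInteger_mul_one_sub q n)

end QShifted

section Summand

variable {F : Type*} [Field F]

/-- The quotient `(x q; q²)_k / (x q; q)_k`, of which the summands are built; like every quotient
it is `0` when the denominator vanishes. -/
def shiftedRatio (x q : F) (k : ℕ) : F :=
  qShifted (x * q) (q ^ 2) k / qShifted (x * q) q k

/-- The summand `cTermParam a q k` without its factor `[3k+1]`: this part satisfies a first order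
recursion in `k` whose coefficient is a rational function of `a`, `q` and `q ^ k`. -/
def cWeight (a q : F) (k : ℕ) : F :=
  (-1) ^ k * (shiftedRatio a q k * shiftedRatio a⁻¹ q k * shiftedRatio 1 q k)

theorem shiftedRatio_zero (x q : F) : shiftedRatio x q 0 = 1 := by
  simp only [shiftedRatio, qShifted_zero, div_one]

theorem shiftedRatio_succ (x q : F) (k : ℕ) :
    shiftedRatio x q (k + 1) =
      shiftedRatio x q k * ((1 - x * q * (q ^ k) ^ 2) / (1 - x * q * q ^ k)) := by
  rw [shiftedRatio, qShifted_succ, qShifted_succ, mul_div_mul_comm, pow_right_comm q 2 k,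
    shiftedRatio]

theorem shiftedRatio_mul_sq {x q : F} {k : ℕ} (h1 : x * q ≠ 1) (h2 : x * q ^ 2 ≠ 1) :
    shiftedRatio (x * q ^ 2) q k =
      shiftedRatio x q (k + 1) * ((1 - x * q ^ 2) / (1 - x * q ^ 2 * q ^ k)) := by
  have h1' : 1 - x * q ≠ 0 := sub_ne_zero.2 h1.symm
  have h2' : 1 - x * q ^ 2 ≠ 0 := sub_ne_zero.2 h2.symm
  have hnum : qShifted (x * q) (q ^ 2) (k + 1) =
      (1 - x * q) * qShifted (x * q ^ 2 * q) (q ^ 2) k := by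
    rw [add_comm, qShifted_add, show x * q * (q ^ 2) ^ 1 = x * q ^ 2 * q by ring]
    simp [qShifted]
  have hden : qShifted (x * q) q (k + 1) * (1 - x * q ^ 2 * q ^ k) =
      (1 - x * q) * (1 - x * q ^ 2) * qShifted (x * q ^ 2 * q) q k := by
    calc _ = qShifted (x * q) q (k + 1 + 1) := by rw [qShifted_succ _ _ (k + 1)]; ring
      _ = qShifted (x * q) q 2 * qShifted (x * q * q ^ 2) q k := by
        rw [← qShifted_add, add_assoc, add_comm]
      _ = _ := by
        rw [show x * q * q ^ 2 = x * q ^ 2 * q by ring]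
        simp only [qShifted, Finset.prod_range_succ, Finset.prod_range_zero, one_mul]
        ring
  rw [shiftedRatio, shiftedRatio, hnum, div_mul_div_comm, hden,
    show ∀ u v w z : F, u * v * w / (u * w * z) = (u * w) * v / ((u * w) * z) by intros; ring,
    mul_div_mul_left _ _ (mul_ne_zero h1' h2')]

theorem shiftedRatio_eq_zero {x q : F} {i k : ℕ} (hik : i < k) (h : x * q ^ (2 * i + 1) = 1) :
    shiftedRatio x q k = 0 := by
  rw [shiftedRatio, qShifted_eq_zero hik (by rw [← h]; ring), zero_div]

theorem cWeight_inv (a q : F) : cWeight a⁻¹ q = cWeight a q := by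
  funext k
  rw [cWeight, inv_inv, mul_comm (shiftedRatio a⁻¹ q k), cWeight]

theorem cTermParam_eq (a q : F) (k : ℕ) :
    cTermParam a q k = qInteger q (3 * k + 1) * cWeight a q k := by
  simp only [cTermParam, cWeight, shiftedRatio, one_mul, div_eq_inv_mul q a, div_mul_div_comm]
  ring

theorem cTermParam_inv (a q : F) : cTermParam a⁻¹ q = cTermParam a q := by
  funext k
  rw [cTermParam_eq, cWeight_inv, cTermParam_eq]

theorem cTerm_eq_cTermParam_one (q : F) : cTerm q = cTermParam 1 q := by
  funext k
  simp only [cTerm, cTermParam, one_mul, div_one, pow_three, mul_assoc]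

theorem cWeight_zero (a q : F) : cWeight a q 0 = 1 := by
  simp only [cWeight, shiftedRatio_zero, pow_zero, mul_one]

theorem cTermParam_zero (a q : F) : cTermParam a q 0 = 1 := by
  simp [cTermParam_eq, cWeight_zero, qInteger]

theorem cWeight_succ {a : F} (ha : a ≠ 0) (q : F) (k : ℕ) :
    cWeight a q (k + 1) = -cWeight a q k * ((1 - a * q * (q ^ k) ^ 2) / (1 - a * q * q ^ k)) *
      ((a - q * (q ^ k) ^ 2) / (a - q * q ^ k)) * ((1 - q * (q ^ k) ^ 2) / (1 - q * q ^ k)) := by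
  have hinv (y : F) : 1 - a⁻¹ * q * y = (a - q * y) / a := by field_simp
  simp only [cWeight, shiftedRatio_succ, one_mul, hinv, div_div_div_cancel_right₀ ha]
  ring

theorem cWeight_eq_zero {a q : F} {i k : ℕ} (hik : i < k)
    (h : a * q ^ (2 * i + 1) = 1 ∨ q ^ (2 * i + 1) = 1) : cWeight a q k = 0 := by
  rcases h with h | h
  · rw [cWeight, shiftedRatio_eq_zero hik h]; ring
  · rw [cWeight, shiftedRatio_eq_zero (x := 1) hik (by rw [one_mul, h])]; ring

theorem cTermParam_eq_zero {a q : F} {i k : ℕ} (hik : i < k)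
    (h : a * q ^ (2 * i + 1) = 1 ∨ q ^ (2 * i + 1) = 1) : cTermParam a q k = 0 := by
  rw [cTermParam_eq, cWeight_eq_zero hik h, mul_zero]

end Summand

section Contiguous

variable {F : Type*} [Field F] {a q : F} {N : ℕ}

theorem cWeight_div_sq (ha : a ≠ 0) (hq : q ≠ 0) (ha1 : a ≠ 1)
    (haN : a * q ^ N ≠ 1) (haq : a ≠ q) (haq2 : a ≠ q ^ 2) :
    cWeight (a / q ^ 2) q (N + 1) =
      -cWeight a q N * ((1 - a * q ^ N) / (1 - a)) *
        ((a - q * (q ^ N) ^ 2) * (a - q ^ 3 * (q ^ N) ^ 2) * (a - q ^ 2) /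
          ((a - q * q ^ N) * (a - q ^ 2 * q ^ N) * (a - q ^ 3 * q ^ N))) *
        ((1 - q * (q ^ N) ^ 2) / (1 - q * q ^ N)) := by
  have hinv {x : F} (hx : a ≠ x) : a⁻¹ * x ≠ 1 := fun h => hx (by field_simp at h; exact h.symm)
  have hA : a / q ^ 2 * q ^ 2 = a := div_mul_cancel₀ _ (pow_ne_zero 2 hq)
  have hfirst : shiftedRatio (a / q ^ 2) q (N + 1) =
      shiftedRatio a q N * ((1 - a * q ^ N) / (1 - a)) := by
    have h := shiftedRatio_mul_sq (x := a / q ^ 2) (q := q) (k := N)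
      (fun h => haq (by field_simp at h; exact h)) (by rwa [hA])
    rw [hA] at h
    have := sub_ne_zero.2 ha1.symm
    have := sub_ne_zero.2 haN.symm
    rw [h]
    field_simp
  have hsecond : shiftedRatio (a / q ^ 2)⁻¹ q (N + 1) =
      shiftedRatio a⁻¹ q N *
        ((a - q * (q ^ N) ^ 2) * (a - q ^ 3 * (q ^ N) ^ 2) * (a - q ^ 2) /
          ((a - q * q ^ N) * (a - q ^ 2 * q ^ N) * (a - q ^ 3 * q ^ N))) := by
    have hsub (y : F) : 1 - a⁻¹ * y = (a - y) / a := by field_simp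
    rw [inv_div, div_eq_inv_mul, shiftedRatio_mul_sq (hinv haq) (hinv haq2),
      shiftedRatio_succ, shiftedRatio_succ]
    simp only [mul_assoc a⁻¹, hsub, div_div_div_cancel_right₀ ha, pow_succ q N]
    rw [mul_div_mul_comm, mul_div_mul_comm]
    ring
  rw [cWeight, cWeight, hfirst, hsecond, shiftedRatio_succ 1, one_mul]
  ring

/-- The right side was found by Gosper summation: the combination of the two summands
telescopes. -/
theorem sum_contiguous (ha : a ≠ 0) (hq : q ≠ 0) (h1 : ∀ i ≤ N, a * q ^ i ≠ 1)
    (h2 : ∀ i ≤ N + 1, a ≠ q ^ (i + 1)) (h3 : ∀ i ≤ N, q ^ (i + 1) ≠ 1) :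
    ∑ k ∈ Finset.range (N + 1),
        ((a - 1) * a * cTermParam (a / q ^ 2) q k + (a - q ^ 2) * cTermParam a q k) =
      cWeight a q N * ((a - q ^ 2) * (a ^ 2 - q ^ 2) * (a - q * (q ^ N) ^ 2) *
        (1 - q * (q ^ N) ^ 2) * q ^ N / ((1 - q) * (a - q * q ^ N) * (a - q ^ 2 * q ^ N))) := by
  have g0 : 1 - a ≠ 0 := sub_ne_zero.2 fun h => h1 0 (Nat.zero_le _) (by simpa using h.symm)
  have g1 : a - q ≠ 0 := sub_ne_zero.2 (by simpa using h2 0 (Nat.zero_le _))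
  have g2 : a - q ^ 2 ≠ 0 := sub_ne_zero.2 (h2 1 (by omega))
  have hq1 : q ≠ 1 := by simpa using h3 0 (Nat.zero_le _)
  have g3 : 1 - q ≠ 0 := sub_ne_zero.2 hq1.symm
  induction N with
  | zero =>
    simp only [zero_add, Finset.sum_range_one, cTermParam_zero, cWeight_zero, pow_zero]
    field_simp
    ring
  | succ N ih =>
    have k1 : 1 - a * q ^ N ≠ 0 := sub_ne_zero.2 (h1 N (by omega)).symm
    have k2 : 1 - a * q * q ^ N ≠ 0 := by
      rw [mul_assoc, ← pow_succ']; exact sub_ne_zero.2 (h1 (N + 1) le_rfl).symm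
    have k3 : 1 - q * q ^ N ≠ 0 := by
      rw [← pow_succ']; exact sub_ne_zero.2 (h3 N (by omega)).symm
    have k4 : a - q * q ^ N ≠ 0 := by
      rw [← pow_succ']; exact sub_ne_zero.2 (h2 N (by omega))
    have k5 : a - q ^ 2 * q ^ N ≠ 0 := by
      rw [← pow_add, add_comm]; exact sub_ne_zero.2 (h2 (N + 1) (by omega))
    have k6 : a - q ^ 3 * q ^ N ≠ 0 := by
      rw [← pow_add, add_comm]; exact sub_ne_zero.2 (h2 (N + 2) le_rfl)
    rw [Finset.sum_range_succ, ih (fun i hi => h1 i (by omega)) (fun i hi => h2 i (by omega))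
        (fun i hi => h3 i (by omega)), cTermParam_eq, cTermParam_eq,
      cWeight_div_sq ha hq (sub_ne_zero.1 g0).symm (h1 N (by omega)) (sub_ne_zero.1 g1)
        (sub_ne_zero.1 g2), cWeight_succ ha, qInteger_eq_div hq1,
      show q ^ (3 * (N + 1) + 1) = q ^ 4 * (q ^ N) ^ 3 by ring, pow_succ q N,
      show a - q * (q ^ N * q) = a - q ^ 2 * q ^ N by ring,
      show a - q ^ 2 * (q ^ N * q) = a - q ^ 3 * q ^ N by ring, show a - 1 = -(1 - a) by ring]
    generalize q ^ N = Q at *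
    field_simp
    ring

end Contiguous

section PowerOfBase

variable {F : Type*} [Field F] {q : F}

theorem cWeight_one {a : F} (ha : a ≠ 0) (haq : a * q ≠ 1) (haq' : a ≠ q) (hq : q ≠ 1) :
    cWeight a q 1 = -1 := by
  rw [← zero_add 1, cWeight_succ ha, cWeight_zero, pow_zero, one_pow]
  simp only [mul_one, div_self (sub_ne_zero.2 haq.symm), div_self (sub_ne_zero.2 haq'),
    div_self (sub_ne_zero.2 hq.symm)]

theorem ne_zero_of_injective_pow (hq : Function.Injective (q ^ · : ℕ → F)) : q ≠ 0 := by
  rintro rfl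
  exact absurd (hq (show (0 : F) ^ 1 = 0 ^ 2 by simp)) (by decide)

theorem pow_succ_ne_one_of_injective_pow (hq : Function.Injective (q ^ · : ℕ → F)) (i : ℕ) :
    q ^ (i + 1) ≠ 1 := fun h => absurd (hq (h.trans (pow_zero q).symm)) i.succ_ne_zero

theorem inv_pow_mul_pow_ne_one (hq : Function.Injective (q ^ · : ℕ → F)) {i j : ℕ} (hij : i ≠ j) :
    (q ^ i)⁻¹ * q ^ j ≠ 1 := fun h =>
  hij (hq ((inv_mul_eq_one₀ (pow_ne_zero i (ne_zero_of_injective_pow hq))).1 h))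

theorem inv_pow_ne_pow_succ (hq : Function.Injective (q ^ · : ℕ → F)) (i j : ℕ) :
    (q ^ i)⁻¹ ≠ q ^ (j + 1) := fun h => by
  have hq0 := pow_ne_zero i (ne_zero_of_injective_pow hq)
  refine pow_succ_ne_one_of_injective_pow hq (i + j) ?_
  rw [add_assoc, pow_add, ← h, mul_inv_cancel₀ hq0]

theorem sum_cTermParam_inv_pow_succ (hq : Function.Injective (q ^ · : ℕ → F)) {m : ℕ}
    (hm : 0 < m) :
    (1 - q ^ (2 * m + 1)) *
        ∑ k ∈ Finset.range (m + 1 + 1), cTermParam (q ^ (2 * (m + 1) + 1))⁻¹ q k =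
      -(q ^ (2 * m + 1) * (1 - q ^ (2 * (m + 1) + 1))) *
        ∑ k ∈ Finset.range (m + 1), cTermParam (q ^ (2 * m + 1))⁻¹ q k := by
  have hq0 : q ≠ 0 := ne_zero_of_injective_pow hq
  have hQ : q ^ (2 * m + 1) ≠ 0 := pow_ne_zero _ hq0
  set a : F := (q ^ (2 * m + 1))⁻¹ with ha
  have hshift : (q ^ (2 * (m + 1) + 1))⁻¹ = a / q ^ 2 := by rw [ha]; field_simp; ring
  have hvanish : a * q ^ (2 * m + 1) = 1 := inv_mul_cancel₀ hQ
  have hcontig := sum_contiguous (N := m + 1) (inv_ne_zero hQ) hq0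
    (fun i hi => inv_pow_mul_pow_ne_one hq (by omega)) (fun i _ => inv_pow_ne_pow_succ hq _ i)
    (fun i _ => pow_succ_ne_one_of_injective_pow hq i)
  rw [← ha, cWeight_eq_zero m.lt_succ_self (.inl hvanish), zero_mul, Finset.sum_add_distrib,
    ← Finset.mul_sum, ← Finset.mul_sum, Finset.sum_range_succ (cTermParam a q),
    cTermParam_eq_zero m.lt_succ_self (.inl hvanish), add_zero, ← hshift] at hcontig
  rw [show q ^ (2 * (m + 1) + 1) = q ^ (2 * m + 1) * q ^ 2 by ring] at hcontig ⊢
  generalize ∑ k ∈ Finset.range (m + 1), cTermParam a q k = S at *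
  generalize ∑ k ∈ Finset.range (m + 1 + 1), cTermParam _ q k = S' at *
  generalize q ^ (2 * m + 1) = Q at *
  linear_combination Q ^ 2 * hcontig - ((1 + a * Q - Q) * S' + Q * S) * hvanish

theorem sum_cTermParam_inv_pow (hq : Function.Injective (q ^ · : ℕ → F)) (m : ℕ) :
    ∑ k ∈ Finset.range (m + 1), cTermParam (q ^ (2 * m + 1))⁻¹ q k =
      (-1) ^ m * q ^ (m ^ 2) * qInteger q (2 * m + 1) := by
  have hq1 : q ≠ 1 := by simpa using pow_succ_ne_one_of_injective_pow hq 0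
  induction m with
  | zero => simp [cTermParam_zero, qInteger]
  | succ m ih =>
    rcases m.eq_zero_or_pos with rfl | hm
    · have hweight : cWeight (q ^ 3)⁻¹ q 1 = -1 :=
        cWeight_one (inv_ne_zero (pow_ne_zero 3 (ne_zero_of_injective_pow hq)))
          (by simpa using inv_pow_mul_pow_ne_one hq (show 3 ≠ 1 by decide))
          (by simpa using inv_pow_ne_pow_succ hq 3 0) hq1
      simp only [zero_add, mul_one, Nat.reduceAdd, Finset.sum_range_succ, Finset.sum_range_zero,
        cTermParam_zero, cTermParam_eq _ _ 1, hweight, qInteger]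
      ring
    · have hstep := sum_cTermParam_inv_pow_succ hq hm
      rw [ih, qInteger_eq_div hq1] at hstep
      have h1 : 1 - q ^ (2 * m + 1) ≠ 0 :=
        sub_ne_zero.2 (pow_succ_ne_one_of_injective_pow hq (2 * m)).symm
      refine mul_left_cancel₀ h1 (hstep.trans ?_)
      rw [qInteger_eq_div hq1]
      ring

end PowerOfBase

section RootOfUnity

variable {F : Type*} [Field F] {ζ : F} {m : ℕ}

theorem sum_cTermParam_div_sq (hζ : IsPrimitiveRoot ζ (2 * m + 1)) (hm : 0 < m) {b : F}
    (hb : b ≠ 0) (hb1 : b ^ (2 * m + 1) ≠ 1) :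
    (b - 1) * b * ∑ k ∈ Finset.range (m + 1), cTermParam (b / ζ ^ 2) ζ k =
      -(b - ζ ^ 2) * ∑ k ∈ Finset.range (m + 1), cTermParam b ζ k := by
  have hpow (i : ℕ) : (ζ ^ i) ^ (2 * m + 1) = 1 := by rw [pow_right_comm, hζ.pow_eq_one, one_pow]
  have hcontig := sum_contiguous (N := m) hb (hζ.ne_zero (by omega))
    (fun i _ h => hb1 (by simpa [mul_pow, hpow] using congrArg (· ^ (2 * m + 1)) h))
    (fun i _ h => hb1 (by rw [h, hpow]))
    (fun i hi => hζ.pow_ne_one_of_pos_of_lt i.succ_ne_zero (by omega))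
  have hlast : 1 - ζ * (ζ ^ m) ^ 2 = 0 := by rw [← hζ.pow_eq_one]; ring
  rw [hlast, Finset.sum_add_distrib, ← Finset.mul_sum, ← Finset.mul_sum] at hcontig
  linear_combination hcontig

/-- The shift `a ↦ a / ζ²` is cyclic of odd order `2 m + 1`, so iterating the contiguous relation
once around the cycle multiplies the sum by a factor different from `1`. -/
theorem sum_cTermParam_eq_zero_of_pow_ne (hζ : IsPrimitiveRoot ζ (2 * m + 1)) (hm : 0 < m) {a : F}
    (ha : a ≠ 0) (ha1 : a ^ (2 * m + 1) ≠ 1) (ha2 : a ^ (2 * m + 1) ≠ -1) :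
    ∑ k ∈ Finset.range (m + 1), cTermParam a ζ k = 0 := by
  have hζ0 : ζ ≠ 0 := hζ.ne_zero (by omega)
  have hpow (i : ℕ) : (ζ ^ i) ^ (2 * m + 1) = 1 := by rw [pow_right_comm, hζ.pow_eq_one, one_pow]
  have hne {b : F} (hb1 : b ^ (2 * m + 1) ≠ 1) : b - 1 ≠ 0 :=
    sub_ne_zero.2 fun h => hb1 (by rw [h, one_pow])
  set V : F → F := fun b => (∑ k ∈ Finset.range (m + 1), cTermParam b ζ k) / (b - 1) with hV
  have hstep {b : F} (hb : b ≠ 0) (hb1 : b ^ (2 * m + 1) ≠ 1) :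
      b * V (b / ζ ^ 2) = -ζ ^ 2 * V b := by
    have h := sum_cTermParam_div_sq hζ hm hb hb1
    have h1 := hne hb1
    have h2 : b - ζ ^ 2 ≠ 0 := sub_ne_zero.2 fun h => hb1 (by rw [h, hpow])
    simp only [hV]
    rw [show b / ζ ^ 2 - 1 = (b - ζ ^ 2) / ζ ^ 2 by field_simp]
    field_simp
    linear_combination h
  have hiter (i : ℕ) : a ^ i * V (a / ζ ^ (2 * i)) = (-1) ^ i * ζ ^ (i * (i + 1)) * V a := by
    induction i with
    | zero => simp
    | succ i ih =>
      have h := hstep (div_ne_zero ha (pow_ne_zero (2 * i) hζ0)) (by rwa [div_pow, hpow, div_one])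
      rw [div_div, ← pow_add, ← mul_add_one 2 i, div_mul_eq_mul_div,
        div_eq_iff (pow_ne_zero _ hζ0)] at h
      linear_combination a ^ i * h - ζ ^ (2 * (i + 1)) * ih
  have hcycle : (a ^ (2 * m + 1) + 1) * V a = 0 := by
    have h := hiter (2 * m + 1)
    rw [mul_comm 2 (2 * m + 1), pow_mul, hζ.pow_eq_one, one_pow, div_one, pow_mul, hζ.pow_eq_one,
      one_pow, (odd_two_mul_add_one m).neg_one_pow] at h
    linear_combination h
  have hVa := (mul_eq_zero.1 hcycle).resolve_left fun h => ha2 (eq_neg_of_add_eq_zero_left h)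
  exact (div_eq_zero_iff.1 hVa).resolve_right (hne ha1)

end RootOfUnity

section TruncSquare

variable {R : Type*} [CommRing R]

theorem truncSquare_eq_sum_ite (c : ℕ → R) (n : ℕ) :
    truncSquare c n = ∑ i ∈ Finset.range n, ∑ j ∈ Finset.range n,
      if i + j < n then c i * c j else 0 := by
  rw [truncSquare, ← Finset.sum_product', Finset.sum_sigma', ← Finset.sum_filter]
  refine Finset.sum_bij' (fun x _ => (x.2, x.1 - x.2)) (fun y _ => ⟨y.1 + y.2, y.1⟩)
    ?_ ?_ ?_ ?_ fun _ _ => rfl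
  · rintro ⟨k, j⟩ h
    simp only [Finset.mem_sigma, Finset.mem_range, Finset.mem_filter, Finset.mem_product] at h ⊢
    omega
  · rintro ⟨i, j⟩ h
    simp only [Finset.mem_sigma, Finset.mem_range, Finset.mem_filter, Finset.mem_product] at h ⊢
    omega
  · rintro ⟨k, j⟩ h
    simp only [Finset.mem_sigma, Finset.mem_range] at h
    simp only [Sigma.mk.injEq, heq_eq_eq, and_true]
    omega
  · rintro ⟨i, j⟩ _
    simp

theorem sum_range_mul_eq_sum_sum {M : Type*} [AddCommMonoid M] (f : ℕ → M) (d e : ℕ) :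
    ∑ i ∈ Finset.range (d * e), f i =
      ∑ l ∈ Finset.range e, ∑ k ∈ Finset.range d, f (d * l + k) := by
  induction e with
  | zero => simp
  | succ e ih => rw [Nat.mul_succ, Finset.sum_range_add, ih, Finset.sum_range_succ]

theorem block_add_lt_iff {m k k' : ℕ} (hk : k ≤ m) (hk' : k' ≤ m) (l l' e : ℕ) :
    (2 * m + 1) * l + k + ((2 * m + 1) * l' + k') < (2 * m + 1) * e ↔ l + l' < e := by
  rw [add_add_add_comm, ← mul_add]
  constructor <;> intro h
  · exact lt_of_mul_lt_mul_left ((Nat.le_add_right _ _).trans_lt h) (Nat.zero_le _)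
  · calc _ < (2 * m + 1) * (l + l' + 1) := by rw [mul_add_one]; omega
      _ ≤ (2 * m + 1) * e := Nat.mul_le_mul_left _ h

theorem sum_range_two_mul_add_one {M : Type*} [AddCommMonoid M] {w : ℕ → M} {m : ℕ}
    (hw : ∀ k, m < k → k < 2 * m + 1 → w k = 0) :
    ∑ k ∈ Finset.range (2 * m + 1), w k = ∑ k ∈ Finset.range (m + 1), w k :=
  (Finset.sum_subset (Finset.range_subset_range.2 (by omega)) fun k hk hk' =>
    hw k (by simpa using hk') (by simpa using hk)).symm

theorem truncSquare_eq_mul_sq_of_blocks {z w C : ℕ → R} {m e : ℕ}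
    (hz : ∀ l < e, ∀ k < 2 * m + 1, z ((2 * m + 1) * l + k) = C l * w k)
    (hw : ∀ k, m < k → k < 2 * m + 1 → w k = 0) :
    truncSquare z ((2 * m + 1) * e) =
      truncSquare C e * (∑ k ∈ Finset.range (m + 1), w k) ^ 2 := by
  have hterm : ∀ l < e, ∀ l' < e, ∀ k < 2 * m + 1, ∀ k' < 2 * m + 1,
      (if (2 * m + 1) * l + k + ((2 * m + 1) * l' + k') < (2 * m + 1) * e then
        z ((2 * m + 1) * l + k) * z ((2 * m + 1) * l' + k') else 0) =
      (if l + l' < e then C l * C l' else 0) * (w k * w k') := by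
    intro l hl l' hl' k hk k' hk'
    rw [hz l hl k hk, hz l' hl' k' hk']
    rcases lt_or_ge m k with hmk | hmk
    · simp [hw k hmk hk]
    rcases lt_or_ge m k' with hmk' | hmk'
    · simp [hw k' hmk' hk']
    simp only [block_add_lt_iff hmk hmk']
    split_ifs <;> ring
  simp only [truncSquare_eq_sum_ite, sum_range_mul_eq_sum_sum, Finset.sum_mul,
    ← sum_range_two_mul_add_one hw, sq]
  refine Finset.sum_congr rfl fun l hl => ?_
  rw [Finset.sum_comm]
  refine Finset.sum_congr rfl fun l' hl' => ?_
  simp only [Finset.mul_sum]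
  simp only [Finset.mem_range] at hl hl'
  exact Finset.sum_congr rfl fun k hk => Finset.sum_congr rfl fun k' hk' =>
    hterm l hl l' hl' k (Finset.mem_range.1 hk) k' (Finset.mem_range.1 hk')

theorem truncSquare_eq_sq_sum {c : ℕ → R} {m : ℕ}
    (hc : ∀ k, m < k → k < 2 * m + 1 → c k = 0) :
    truncSquare c (2 * m + 1) = (∑ k ∈ Finset.range (m + 1), c k) ^ 2 := by
  have h := truncSquare_eq_mul_sq_of_blocks (z := c) (C := 1) (e := 1)
    (fun l hl k _ => by simp [Nat.lt_one_iff.1 hl]) hc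
  simpa [truncSquare] using h

end TruncSquare

theorem truncSquare_cTermParam_pow {F : Type*} [Field F] {q : F}
    (hq : Function.Injective (q ^ · : ℕ → F)) (m : ℕ) :
    truncSquare (cTermParam (q ^ (2 * m + 1)) q) (2 * m + 1) =
      q ^ (2 * m ^ 2) * qInteger q (2 * m + 1) ^ 2 := by
  have hq0 : q ^ (2 * m + 1) ≠ 0 := pow_ne_zero _ (ne_zero_of_injective_pow hq)
  rw [← cTermParam_inv, truncSquare_eq_sq_sum, sum_cTermParam_inv_pow hq]
  · rw [mul_pow, mul_pow, pow_right_comm, neg_one_sq, one_pow, one_mul, ← pow_mul,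
      mul_comm (m ^ 2)]
  · exact fun k hk _ => cTermParam_eq_zero hk (.inl (inv_mul_cancel₀ hq0))

section SpecializesTo

variable {R K L : Type*} [CommRing R] [Field K] [Algebra R K] [Field L] {φ : R →+* L}

/-- The fraction `x` over `R` is defined at the point `φ : R →+* L`, where it takes the value `z`:
it can be written as `u / v` with `φ v ≠ 0`. The equations are cleared of denominators, so that no
quotient of `K` or `L` is involved. -/
def SpecializesTo (φ : R →+* L) (x : K) (z : L) : Prop :=
  ∃ u v : R, φ v ≠ 0 ∧ x * algebraMap R K v = algebraMap R K u ∧ z * φ v = φ u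

namespace SpecializesTo

variable {x y q : K} {z w ζ : L}

protected theorem algebraMap (φ : R →+* L) (r : R) : SpecializesTo φ (algebraMap R K r) (φ r) :=
  ⟨r, 1, by simp, by simp, by simp⟩

protected theorem zero : SpecializesTo φ (0 : K) 0 := by
  simpa using SpecializesTo.algebraMap (K := K) φ 0

protected theorem one : SpecializesTo φ (1 : K) 1 := by
  simpa using SpecializesTo.algebraMap (K := K) φ 1

protected theorem neg (hx : SpecializesTo φ x z) : SpecializesTo φ (-x) (-z) := by
  obtain ⟨u, v, hv, hxv, hzv⟩ := hx
  exact ⟨-u, v, hv, by rw [neg_mul, hxv, map_neg], by rw [neg_mul, hzv, map_neg]⟩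

protected theorem add (hx : SpecializesTo φ x z) (hy : SpecializesTo φ y w) :
    SpecializesTo φ (x + y) (z + w) := by
  obtain ⟨u, v, hv, hxv, hzv⟩ := hx
  obtain ⟨s, t, ht, hyt, hwt⟩ := hy
  refine ⟨u * t + s * v, v * t, by simp [hv, ht], ?_, ?_⟩ <;> simp only [map_add, map_mul]
  · rw [← hxv, ← hyt]; ring
  · rw [← hzv, ← hwt]; ring

protected theorem mul (hx : SpecializesTo φ x z) (hy : SpecializesTo φ y w) :
    SpecializesTo φ (x * y) (z * w) := by
  obtain ⟨u, v, hv, hxv, hzv⟩ := hx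
  obtain ⟨s, t, ht, hyt, hwt⟩ := hy
  refine ⟨u * s, v * t, by simp [hv, ht], ?_, ?_⟩ <;> simp only [map_mul]
  · rw [← hxv, ← hyt]; ring
  · rw [← hzv, ← hwt]; ring

protected theorem sub (hx : SpecializesTo φ x z) (hy : SpecializesTo φ y w) :
    SpecializesTo φ (x - y) (z - w) := by
  simpa only [sub_eq_add_neg] using hx.add hy.neg

protected theorem pow (hx : SpecializesTo φ x z) (n : ℕ) : SpecializesTo φ (x ^ n) (z ^ n) := by
  obtain ⟨u, v, hv, hxv, hzv⟩ := hx
  refine ⟨u ^ n, v ^ n, by simp [hv], ?_, ?_⟩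
  · rw [map_pow, map_pow, ← mul_pow, hxv]
  · rw [map_pow, map_pow, ← mul_pow, hzv]

protected theorem sum {ι : Type*} {s : Finset ι} {f : ι → K} {g : ι → L}
    (h : ∀ i ∈ s, SpecializesTo φ (f i) (g i)) :
    SpecializesTo φ (∑ i ∈ s, f i) (∑ i ∈ s, g i) := by
  classical
  induction s using Finset.induction_on with
  | empty => simpa using SpecializesTo.zero
  | insert i s hi ih =>
    rw [Finset.sum_insert hi, Finset.sum_insert hi]
    exact (h i (Finset.mem_insert_self i s)).add
      (ih fun j hj => h j (Finset.mem_insert_of_mem hj))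

protected theorem prod {ι : Type*} {s : Finset ι} {f : ι → K} {g : ι → L}
    (h : ∀ i ∈ s, SpecializesTo φ (f i) (g i)) :
    SpecializesTo φ (∏ i ∈ s, f i) (∏ i ∈ s, g i) := by
  classical
  induction s using Finset.induction_on with
  | empty => simpa using SpecializesTo.one
  | insert i s hi ih =>
    rw [Finset.prod_insert hi, Finset.prod_insert hi]
    exact (h i (Finset.mem_insert_self i s)).mul
      (ih fun j hj => h j (Finset.mem_insert_of_mem hj))

protected theorem truncSquare {f : ℕ → K} {g : ℕ → L} {n : ℕ}
    (h : ∀ k < n, SpecializesTo φ (f k) (g k)) :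
    SpecializesTo φ (truncSquare f n) (truncSquare g n) := by
  refine SpecializesTo.sum fun k hk => SpecializesTo.sum fun j hj => ?_
  rw [Finset.mem_range] at hk hj
  exact (h j (by omega)).mul (h (k - j) (by omega))

protected theorem qInteger (hq : SpecializesTo φ q ζ) (n : ℕ) :
    SpecializesTo φ (qInteger q n) (qInteger ζ n) :=
  SpecializesTo.sum fun i _ => hq.pow i

protected theorem qShifted (hx : SpecializesTo φ x z) (hq : SpecializesTo φ q ζ) (k : ℕ) :
    SpecializesTo φ (qShifted x q k) (qShifted z ζ k) :=
  SpecializesTo.prod fun i _ => SpecializesTo.one.sub (hx.mul (hq.pow i))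

variable [IsFractionRing R K]

theorem unique (hz : SpecializesTo φ x z) (hw : SpecializesTo φ x w) : z = w := by
  obtain ⟨u, v, hv, hxv, hzv⟩ := hz
  obtain ⟨s, t, ht, hxt, hwt⟩ := hw
  have hcross : u * t = s * v := IsFractionRing.injective R K <| by
    rw [map_mul, map_mul, ← hxv, ← hxt]; ring
  refine mul_right_cancel₀ (mul_ne_zero hv ht) ?_
  rw [← mul_assoc, hzv, mul_comm (φ v), ← mul_assoc, hwt, ← map_mul, ← map_mul, hcross]

theorem ne_zero (hx : SpecializesTo φ x z) (hz : z ≠ 0) : x ≠ 0 := by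
  rintro rfl
  exact hz (hx.unique SpecializesTo.zero)

protected theorem inv (hx : SpecializesTo φ x z) (hz : z ≠ 0) : SpecializesTo φ x⁻¹ z⁻¹ := by
  have hx0 : x ≠ 0 := hx.ne_zero hz
  obtain ⟨u, v, hv, hxv, hzv⟩ := hx
  refine ⟨v, u, hzv ▸ mul_ne_zero hz hv, ?_, ?_⟩
  · rw [← hxv, inv_mul_cancel_left₀ hx0]
  · rw [← hzv, inv_mul_cancel_left₀ hz]

protected theorem div (hx : SpecializesTo φ x z) (hy : SpecializesTo φ y w) (hw : w ≠ 0) :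
    SpecializesTo φ (x / y) (z / w) := by
  simpa only [div_eq_mul_inv] using hx.mul (hy.inv hw)

theorem pow_ne_one (hq : SpecializesTo φ q ζ) {i : ℕ} (h : ζ ^ i ≠ 1) : q ^ i ≠ 1 := fun hqi =>
  h ((hqi ▸ hq.pow i).unique SpecializesTo.one)

protected theorem shiftedRatio (hx : SpecializesTo φ x z) (hq : SpecializesTo φ q ζ) {k : ℕ}
    (h : ∀ i < k, z * ζ ^ (i + 1) ≠ 1) :
    SpecializesTo φ (shiftedRatio x q k) (shiftedRatio z ζ k) :=
  ((hx.mul hq).qShifted (hq.pow 2) k).div ((hx.mul hq).qShifted hq k) <|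
    qShifted_ne_zero fun i hi => by rw [mul_assoc, ← pow_succ']; exact h i hi

protected theorem cTermParam {a : K} {α : L} (ha : SpecializesTo φ a α)
    (hq : SpecializesTo φ q ζ) (hα : α ≠ 0) {k : ℕ} (h : ∀ i < k, α * ζ ^ (i + 1) ≠ 1)
    (hinv : ∀ i < k, α⁻¹ * ζ ^ (i + 1) ≠ 1) (hone : ∀ i < k, ζ ^ (i + 1) ≠ 1) :
    SpecializesTo φ (cTermParam a q k) (cTermParam α ζ k) := by
  rw [cTermParam_eq, cTermParam_eq]
  exact (hq.qInteger _).mul <| (SpecializesTo.one.neg.pow k).mul <|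
    ((ha.shiftedRatio hq h).mul ((ha.inv hα).shiftedRatio hq hinv)).mul
      (SpecializesTo.one.shiftedRatio hq fun i hi => by rw [one_mul]; exact hone i hi)

end SpecializesTo

end SpecializesTo

theorem ratFunc_X_pow_ne_C {L : Type*} [Field L] {n : ℕ} (hn : n ≠ 0) (c : L) :
    (RatFunc.X : RatFunc L) ^ n ≠ RatFunc.C c := by
  rw [← RatFunc.algebraMap_X, ← map_pow, ← RatFunc.algebraMap_C]
  exact fun h => hn (by
    simpa using congrArg Polynomial.natDegree (RatFunc.algebraMap_injective L h))

/-- For all but finitely many parameters this is `sum_cTermParam_eq_zero_of_pow_ne`; the others are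
specializations of an indeterminate parameter. -/
theorem sum_cTermParam_eq_zero {L : Type*} [Field L] {ζ α : L} {m : ℕ}
    (hζ : IsPrimitiveRoot ζ (2 * m + 1)) (hm : 0 < m) (hα : α ≠ 0)
    (h : ∀ i < m, α * ζ ^ (i + 1) ≠ 1) (hinv : ∀ i < m, α⁻¹ * ζ ^ (i + 1) ≠ 1) :
    ∑ k ∈ Finset.range (m + 1), cTermParam α ζ k = 0 := by
  have hζX : SpecializesTo (Polynomial.evalRingHom α) (RatFunc.C ζ) ζ := by
    simpa using SpecializesTo.algebraMap (K := RatFunc L) (Polynomial.evalRingHom α)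
      (Polynomial.C ζ)
  have hX : SpecializesTo (Polynomial.evalRingHom α) (RatFunc.X : RatFunc L) α := by
    simpa using SpecializesTo.algebraMap (K := RatFunc L) (Polynomial.evalRingHom α) Polynomial.X
  have hgeneric :
      ∑ k ∈ Finset.range (m + 1), cTermParam (RatFunc.X : RatFunc L) (RatFunc.C ζ) k = 0 := by
    refine sum_cTermParam_eq_zero_of_pow_ne (hζ.map_of_injective RatFunc.C_injective) hm
      RatFunc.X_ne_zero ?_ ?_
    · simpa using ratFunc_X_pow_ne_C (2 * m).succ_ne_zero (1 : L)
    · simpa using ratFunc_X_pow_ne_C (2 * m).succ_ne_zero (-1 : L)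
  refine (SpecializesTo.sum fun k hk => hX.cTermParam hζX hα ?_ ?_ ?_).unique
    (hgeneric ▸ SpecializesTo.zero)
  all_goals intro i hi; rw [Finset.mem_range] at hk
  · exact h i (by omega)
  · exact hinv i (by omega)
  · exact hζ.pow_ne_one_of_pos_of_lt i.succ_ne_zero (by omega)

section QBinomial

variable {F : Type*} [Field F] {q : F}

/-- The `q`-binomial coefficient `[j + k choose j]_q`. It is a polynomial in `q`, so it can be
specialized to a root of unity although its denominator may vanish there. -/
def qBinomial (q : F) (j k : ℕ) : F :=
  qShifted q q (j + k) / (qShifted q q j * qShifted q q k)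

theorem qShifted_self_ne_zero (hq : ∀ i, q ^ (i + 1) ≠ 1) (k : ℕ) : qShifted q q k ≠ 0 :=
  qShifted_ne_zero fun i _ => by rw [← pow_succ']; exact hq i

theorem qBinomial_succ_succ (hq : ∀ i, q ^ (i + 1) ≠ 1) (j k : ℕ) :
    qBinomial q (j + 1) (k + 1) =
      qBinomial q j (k + 1) + q ^ (j + 1) * qBinomial q (j + 1) k := by
  have hj := qShifted_self_ne_zero hq j
  have hk := qShifted_self_ne_zero hq k
  have hj1 : 1 - q * q ^ j ≠ 0 := by rw [← pow_succ']; exact sub_ne_zero.2 (hq j).symm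
  have hk1 : 1 - q * q ^ k ≠ 0 := by rw [← pow_succ']; exact sub_ne_zero.2 (hq k).symm
  rw [qBinomial, qBinomial, qBinomial, show j + 1 + (k + 1) = j + k + 1 + 1 by ring,
    show j + (k + 1) = j + k + 1 by ring, show j + 1 + k = j + k + 1 by ring,
    qShifted_succ q q (j + k + 1), qShifted_succ q q j, qShifted_succ q q k]
  field_simp
  ring

theorem qShifted_sq_mul_qShifted_mul_qShifted_neg {R : Type*} [CommRing R] (q : R) (k : ℕ) :
    qShifted q (q ^ 2) k * (qShifted q q k * qShifted (-q) q k) = qShifted q q (k + k) := by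
  induction k with
  | zero => simp [qShifted_zero]
  | succ k ih =>
    rw [show k + 1 + (k + 1) = k + k + 1 + 1 by ring, qShifted_succ _ _ (k + k + 1),
      qShifted_succ _ _ (k + k), ← ih, qShifted_succ, qShifted_succ, qShifted_succ]
    ring

theorem shiftedRatio_one_eq (hq : ∀ i, q ^ (i + 1) ≠ 1) {k : ℕ} (hk : qShifted (-q) q k ≠ 0) :
    shiftedRatio 1 q k = qBinomial q k k / qShifted (-q) q k := by
  have hQ := qShifted_self_ne_zero hq k
  rw [shiftedRatio, qBinomial, one_mul, ← qShifted_sq_mul_qShifted_mul_qShifted_neg]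
  field_simp

end QBinomial

section SpecializesBlockwise

variable {R K L : Type*} [CommRing R] [Field K] [Algebra R K] [Field L] {φ : R →+* L}

theorem exists_specializesTo_qBinomial {q : K} {ζ : L} (hq : SpecializesTo φ q ζ)
    (hq1 : ∀ i, q ^ (i + 1) ≠ 1) (j k : ℕ) : ∃ z, SpecializesTo φ (qBinomial q j k) z := by
  induction j generalizing k with
  | zero =>
    refine ⟨1, ?_⟩
    rw [qBinomial, zero_add, qShifted_zero, one_mul, div_self (qShifted_self_ne_zero hq1 k)]
    exact SpecializesTo.one
  | succ j ihj =>
    induction k with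
    | zero =>
      refine ⟨1, ?_⟩
      rw [qBinomial, add_zero, qShifted_zero, mul_one, div_self (qShifted_self_ne_zero hq1 _)]
      exact SpecializesTo.one
    | succ k ihk =>
      obtain ⟨z, hz⟩ := ihj (k + 1)
      obtain ⟨w, hw⟩ := ihk
      exact ⟨_, qBinomial_succ_succ hq1 j k ▸ hz.add ((hq.pow (j + 1)).mul hw)⟩

theorem exists_specializesTo_shiftedRatio_one [IsFractionRing R K] {q : K} {ζ : L}
    (hq : SpecializesTo φ q ζ) (hq1 : ∀ i, q ^ (i + 1) ≠ 1) (hζ : ∀ i, ζ ^ (i + 1) ≠ -1)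
    (k : ℕ) : ∃ z, SpecializesTo φ (shiftedRatio 1 q k) z := by
  have hden : SpecializesTo φ (qShifted (-q) q k) (qShifted (-ζ) ζ k) := hq.neg.qShifted hq k
  have hne : qShifted (-ζ) ζ k ≠ 0 := qShifted_ne_zero fun i _ h => hζ i <| by
    rw [pow_succ', ← h, neg_mul, neg_neg]
  obtain ⟨z, hz⟩ := exists_specializesTo_qBinomial hq hq1 k k
  exact ⟨_, shiftedRatio_one_eq hq1 (hden.ne_zero hne) ▸ hz.div hden hne⟩

/-- On the `l`-th block of `d` consecutive indices, the sequence `f` specializes to a multiple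
`C l` of one and the same sequence `w`. -/
def SpecializesBlockwise (φ : R →+* L) (d : ℕ) (f : ℕ → K) (w : ℕ → L) : Prop :=
  ∃ C : ℕ → L, ∀ l, ∀ k < d, SpecializesTo φ (f (d * l + k)) (C l * w k)

namespace SpecializesBlockwise

variable {d : ℕ} {q : K} {ζ : L}

protected theorem mul {f g : ℕ → K} {v w : ℕ → L} (hf : SpecializesBlockwise φ d f v)
    (hg : SpecializesBlockwise φ d g w) :
    SpecializesBlockwise φ d (fun k => f k * g k) fun k => v k * w k := by
  obtain ⟨C, hC⟩ := hf
  obtain ⟨D, hD⟩ := hg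
  exact ⟨C * D, fun l k hk => by
    rw [Pi.mul_apply, mul_mul_mul_comm]; exact (hC l k hk).mul (hD l k hk)⟩

protected theorem neg_one_pow :
    SpecializesBlockwise φ d (fun k => (-1 : K) ^ k) fun k => (-1) ^ k :=
  ⟨fun l => (-1) ^ (d * l), fun l k _ => by
    rw [← pow_add]; exact SpecializesTo.one.neg.pow _⟩

protected theorem qInteger (hq : SpecializesTo φ q ζ) (hζ : ζ ^ d = 1) (hζ1 : ζ ≠ 1) :
    SpecializesBlockwise φ d (fun k => qInteger q (3 * k + 1)) fun k => qInteger ζ (3 * k + 1) := by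
  refine ⟨1, fun l k _ => ?_⟩
  have hperiod : qInteger ζ (3 * (d * l + k) + 1) = qInteger ζ (3 * k + 1) := by
    rw [qInteger_eq_div hζ1, qInteger_eq_div hζ1,
      show 3 * (d * l + k) + 1 = d * (3 * l) + (3 * k + 1) by ring, pow_add, pow_mul, hζ, one_pow,
      one_mul]
  simpa only [Pi.one_apply, one_mul, hperiod] using hq.qInteger (3 * (d * l + k) + 1)

variable [IsFractionRing R K]

protected theorem shiftedRatio {x : K} {ξ : L} (hx : SpecializesTo φ x ξ)
    (hq : SpecializesTo φ q ζ) (hζ : ζ ^ d = 1)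
    (hstart : ∀ k, ∃ z, SpecializesTo φ (shiftedRatio x q k) z)
    (hξ : ∀ i, i + 1 < d → ξ * ζ ^ (i + 1) ≠ 1) :
    SpecializesBlockwise φ d (shiftedRatio x q) (shiftedRatio ξ ζ) := by
  choose C hC using fun l => hstart (d * l)
  refine ⟨C, fun l k hk => ?_⟩
  have hpow : ζ ^ (d * l) = 1 := by rw [pow_mul, hζ, one_pow]
  have hshift : SpecializesTo φ (x * q * q ^ (d * l)) (ξ * ζ) := by
    simpa only [hpow, mul_one] using (hx.mul hq).mul (hq.pow (d * l))
  have hshift_sq : SpecializesTo φ (x * q * (q ^ 2) ^ (d * l)) (ξ * ζ) := by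
    simpa only [pow_right_comm ζ, hpow, one_pow, mul_one] using
      (hx.mul hq).mul ((hq.pow 2).pow (d * l))
  rw [shiftedRatio, qShifted_add, qShifted_add, mul_div_mul_comm]
  refine (hC l).mul ((hshift_sq.qShifted (hq.pow 2) k).div (hshift.qShifted hq k) ?_)
  exact qShifted_ne_zero fun i hi => by rw [mul_assoc, ← pow_succ']; exact hξ i (by omega)

protected theorem cTermParam {a : K} {α : L} (ha : SpecializesTo φ a α) (hα : α ≠ 0)
    (hq : SpecializesTo φ q ζ) (hq1 : ∀ i, q ^ (i + 1) ≠ 1) (hζ : IsPrimitiveRoot ζ d)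
    (hζ1 : ζ ≠ 1) (hζ2 : ∀ i, ζ ^ (i + 1) ≠ -1)
    (hstart : ∀ k, ∃ z, SpecializesTo φ (shiftedRatio a q k) z)
    (hstart_inv : ∀ k, ∃ z, SpecializesTo φ (shiftedRatio a⁻¹ q k) z)
    (h : ∀ i, i + 1 < d → α * ζ ^ (i + 1) ≠ 1) (hinv : ∀ i, i + 1 < d → α⁻¹ * ζ ^ (i + 1) ≠ 1) :
    SpecializesBlockwise φ d (cTermParam a q) (cTermParam α ζ) := by
  have hone : ∀ i, i + 1 < d → 1 * ζ ^ (i + 1) ≠ 1 := fun i hi => by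
    rw [one_mul]; exact hζ.pow_ne_one_of_pos_of_lt i.succ_ne_zero hi
  rw [funext (cTermParam_eq a q), funext (cTermParam_eq α ζ)]
  exact (SpecializesBlockwise.qInteger hq hζ.pow_eq_one hζ1).mul <|
    SpecializesBlockwise.neg_one_pow.mul <|
      ((SpecializesBlockwise.shiftedRatio ha hq hζ.pow_eq_one hstart h).mul
        (SpecializesBlockwise.shiftedRatio (ha.inv hα) hq hζ.pow_eq_one hstart_inv hinv)).mul
        (SpecializesBlockwise.shiftedRatio SpecializesTo.one hq hζ.pow_eq_one
          (exists_specializesTo_shiftedRatio_one hq hq1 hζ2) hone)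

omit [IsFractionRing R K] in
theorem truncSquare_zero {f : ℕ → K} {w : ℕ → L} {m : ℕ}
    (hf : SpecializesBlockwise φ (2 * m + 1) f w) (hw : ∀ k, m < k → k < 2 * m + 1 → w k = 0)
    (hsum : ∑ k ∈ Finset.range (m + 1), w k = 0) (e : ℕ) :
    SpecializesTo φ (truncSquare f ((2 * m + 1) * e)) 0 := by
  obtain ⟨C, hC⟩ := hf
  have hvalue : truncSquare (fun i => C (i / (2 * m + 1)) * w (i % (2 * m + 1)))
      ((2 * m + 1) * e) = 0 := by
    rw [truncSquare_eq_mul_sq_of_blocks (C := C) (w := w) (fun l _ k hk => ?_) hw, hsum,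
      zero_pow two_ne_zero, mul_zero]
    simp [Nat.mul_add_div, Nat.div_eq_of_lt hk, Nat.mod_eq_of_lt hk]
  rw [← hvalue]
  refine SpecializesTo.truncSquare fun i _ => ?_
  simpa only [Nat.div_add_mod] using
    hC (i / (2 * m + 1)) (i % (2 * m + 1)) (Nat.mod_lt i (2 * m).succ_pos)

end SpecializesBlockwise

end SpecializesBlockwise

section Congruence

variable {R K : Type*} [CommRing R] [IsDomain R] [UniqueFactorizationMonoid R] [Field K]
  [Algebra R K] [IsFractionRing R K] {m : R} {x y z : K}

theorem mul_algebraMap_den (x : K) :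
    x * algebraMap R K (IsFractionRing.den R x) = algebraMap R K (IsFractionRing.num R x) := by
  have hden : algebraMap R K (IsFractionRing.den R x) ≠ 0 :=
    IsFractionRing.to_map_ne_zero_of_mem_nonZeroDivisors (IsFractionRing.den R x).2
  exact ((div_eq_iff hden).1 (IsFractionRing.mk'_num_den' R x)).symm

theorem SpecializesTo.num_den {L : Type*} [Field L] {φ : R →+* L} {c : L}
    (hx : SpecializesTo φ x c) :
    φ (IsFractionRing.den R x) ≠ 0 ∧
      c * φ (IsFractionRing.den R x) = φ (IsFractionRing.num R x) := by
  obtain ⟨u, v, hv, hxv, hcv⟩ := hx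
  have hcross : IsFractionRing.num R x * v = IsFractionRing.den R x * u :=
    IsFractionRing.injective R K <| by
      rw [map_mul, map_mul, ← mul_algebraMap_den, ← hxv]; ring
  obtain ⟨w, rfl⟩ : (IsFractionRing.den R x : R) ∣ v :=
    (IsFractionRing.num_den_reduced R x).symm.dvd_of_dvd_mul_left ⟨u, hcross⟩
  rw [mul_left_comm] at hcross
  have hu := mul_left_cancel₀ (nonZeroDivisors.coe_ne_zero _) hcross
  rw [map_mul] at hv hcv
  refine ⟨left_ne_zero_of_mul hv, mul_right_cancel₀ (right_ne_zero_of_mul hv) ?_⟩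
  rw [mul_assoc, hcv, ← hu, map_mul]

theorem fracCongr_iff_dvd_num : FracCongr m x y ↔ m ∣ IsFractionRing.num R (x - y) := by
  constructor
  · rintro ⟨u, v, hv, hvm, h⟩
    have hcross : IsFractionRing.num R (x - y) * v = m * (u * IsFractionRing.den R (x - y)) :=
      IsFractionRing.injective R K <| by
        have hv' : algebraMap R K v ≠ 0 := by simpa using hv
        rw [map_mul, ← mul_algebraMap_den, mul_right_comm, (eq_div_iff hv').1 h, ← map_mul,
          mul_assoc]
    exact hvm.symm.dvd_of_dvd_mul_right ⟨_, hcross⟩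
  · rintro ⟨u, hu⟩
    refine ⟨u, IsFractionRing.den R (x - y), nonZeroDivisors.coe_ne_zero _, ?_, ?_⟩
    · exact fun d hden hm => IsFractionRing.num_den_reduced R (x - y) (hm.trans ⟨u, hu⟩) hden
    · rw [← hu, IsFractionRing.mk'_num_den']

omit [UniqueFactorizationMonoid R] [IsFractionRing R K] in
theorem fracCongr_algebraMap_of_dvd_sub {r s : R} (h : m ∣ r - s) :
    FracCongr m (algebraMap R K r) (algebraMap R K s) := by
  obtain ⟨u, hu⟩ := h
  exact ⟨u, 1, one_ne_zero, isRelPrime_one_left, by rw [← hu, map_sub, map_one, div_one]⟩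

theorem FracCongr.trans (hxy : FracCongr m x y) (hyz : FracCongr m y z) : FracCongr m x z := by
  obtain ⟨u, v, hv, hvm, h⟩ := hxy
  obtain ⟨s, t, ht, htm, h'⟩ := hyz
  have hv' : algebraMap R K v ≠ 0 := by simpa using hv
  have ht' : algebraMap R K t ≠ 0 := by simpa using ht
  refine ⟨u * t + s * v, v * t, mul_ne_zero hv ht, hvm.mul_left htm, ?_⟩
  rw [← sub_add_sub_cancel x y z, h, h']
  simp only [map_mul, map_add]
  field_simp

theorem FracCongr.mul {m' : R} (h : FracCongr m x y) (h' : FracCongr m' x y)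
    (hmm' : IsRelPrime m m') : FracCongr (m * m') x y :=
  fracCongr_iff_dvd_num.2 <|
    hmm'.mul_dvd (fracCongr_iff_dvd_num.1 h) (fracCongr_iff_dvd_num.1 h')

theorem fracCongr_prod {ι : Type*} {s : Finset ι} {f : ι → R}
    (hf : (s : Set ι).Pairwise (Function.onFun IsRelPrime f)) (h : ∀ i ∈ s, FracCongr (f i) x y) :
    FracCongr (∏ i ∈ s, f i) x y :=
  fracCongr_iff_dvd_num.2 <|
    Finset.prod_dvd_of_isRelPrime hf fun i hi => fracCongr_iff_dvd_num.1 (h i hi)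

theorem fracCongr_of_specializesTo {L : Type*} [Field L] {φ : R →+* L} {c : L}
    (hφ : ∀ r, φ r = 0 → m ∣ r) (hx : SpecializesTo φ x c) (hy : SpecializesTo φ y c) :
    FracCongr m x y := by
  refine fracCongr_iff_dvd_num.2 (hφ _ ?_)
  rw [← (hx.sub hy).num_den.2, sub_self, zero_mul]

/-- The denominator of `x - y` is prime to `m`, but its image under `f` is prime to `m'` only
because `x - y` is defined at `ψ.comp f`. -/
theorem FracCongr.specialize {S K' L : Type*} [CommRing S] [Field K'] [Algebra S K'] [Field L]
    {f : R →+* S} {ψ : S →+* L} {m' : S} {x' y' : K'} {c : L} (h : FracCongr m x y)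
    (hx : SpecializesTo ((algebraMap S K').comp f) x x')
    (hy : SpecializesTo ((algebraMap S K').comp f) y y')
    (hxy : SpecializesTo (ψ.comp f) (x - y) c) (hm : m' ∣ f m)
    (hψ : ∀ s, ψ s ≠ 0 → IsRelPrime s m') : FracCongr m' x' y' := by
  obtain ⟨u, hu⟩ := hm.trans (map_dvd f (fracCongr_iff_dvd_num.1 h))
  obtain ⟨hden, hvalue⟩ := (hx.sub hy).num_den
  refine ⟨u, f (IsFractionRing.den R (x - y)), ?_, hψ _ hxy.num_den.1, ?_⟩
  · rintro h0
    simp [h0] at hden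
  · rw [← hu]
    exact eq_div_of_mul_eq hden hvalue

end Congruence

section Specializations

variable {R K L : Type*} [CommRing R] [Field K] [Algebra R K] [IsFractionRing R K] [Field L]
  {φ : R →+* L} {a q : K} {α ζ : L}

theorem specializesTo_truncSquare_cTermParam_pow {m : ℕ} (hζ : Function.Injective (ζ ^ · : ℕ → L))
    (hq : SpecializesTo φ q ζ) (ha : SpecializesTo φ a (ζ ^ (2 * m + 1))) :
    SpecializesTo φ (truncSquare (cTermParam a q) (2 * m + 1))
      (ζ ^ (2 * m ^ 2) * qInteger ζ (2 * m + 1) ^ 2) := by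
  rw [← truncSquare_cTermParam_pow hζ]
  refine SpecializesTo.truncSquare fun k hk => ha.cTermParam hq
    (pow_ne_zero _ (ne_zero_of_injective_pow hζ)) (fun i _ => ?_) (fun i hi => ?_) fun i _ =>
      pow_succ_ne_one_of_injective_pow hζ i
  · rw [← pow_add]
    exact pow_succ_ne_one_of_injective_pow hζ _
  · exact inv_pow_mul_pow_ne_one hζ (by omega)

theorem specializesTo_truncSquare_cTermParam_one {n : ℕ} (hq : SpecializesTo φ q ζ)
    (ha : SpecializesTo φ a 1) (hζ : ∀ i, i + 1 < n → ζ ^ (i + 1) ≠ 1) :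
    SpecializesTo φ (truncSquare (cTermParam a q) n) (truncSquare (cTerm ζ) n) := by
  rw [cTerm_eq_cTermParam_one]
  refine SpecializesTo.truncSquare fun k hk => ha.cTermParam hq one_ne_zero ?_ ?_ ?_ <;> intro i hi
  · rw [one_mul]; exact hζ i (by omega)
  · rw [inv_one, one_mul]; exact hζ i (by omega)
  · exact hζ i (by omega)

theorem pow_ne_neg_one_of_odd [NeZero (2 : L)] {d : ℕ} (hζ : ζ ^ d = 1) (hd : Odd d) (i : ℕ) :
    ζ ^ i ≠ -1 := fun h => two_ne_zero (α := L) <| by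
  have hpow : (-1 : L) ^ d = 1 := by rw [← h, pow_right_comm, hζ, one_pow]
  rw [hd.neg_one_pow] at hpow
  linear_combination -hpow

theorem specializesTo_truncSquare_cTermParam_zero [NeZero (2 : L)] {d n : ℕ}
    (hζ : IsPrimitiveRoot ζ d) (hd : Odd d) (hd1 : d ≠ 1) (hdn : d ∣ n) (hα : α ≠ 0)
    (hq : SpecializesTo φ q ζ) (hq1 : ∀ i, q ^ (i + 1) ≠ 1) (ha : SpecializesTo φ a α)
    (hstart : ∀ k, ∃ z, SpecializesTo φ (shiftedRatio a q k) z)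
    (hstart_inv : ∀ k, ∃ z, SpecializesTo φ (shiftedRatio a⁻¹ q k) z)
    (h : ∀ i, i + 1 < d → α * ζ ^ (i + 1) ≠ 1) (hinv : ∀ i, i + 1 < d → α⁻¹ * ζ ^ (i + 1) ≠ 1) :
    SpecializesTo φ (truncSquare (cTermParam a q) n) 0 := by
  obtain ⟨e, rfl⟩ := hdn
  have hblock := SpecializesBlockwise.cTermParam ha hα hq hq1 hζ
    (fun h1 => hd1 (hζ.unique (h1 ▸ IsPrimitiveRoot.one)))
    (fun i => pow_ne_neg_one_of_odd hζ.pow_eq_one hd _) hstart hstart_inv h hinv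
  obtain ⟨m, rfl⟩ := hd
  refine hblock.truncSquare_zero (fun k hk _ => cTermParam_eq_zero hk (Or.inr hζ.pow_eq_one))
    (sum_cTermParam_eq_zero hζ (by omega) hα (fun i hi => h i ?_) fun i hi => hinv i ?_) e <;> omega

omit [IsFractionRing R K] in
theorem specializesTo_pow_mul_qInteger_sq_zero {n : ℕ} (hq : SpecializesTo φ q ζ) (hζ : ζ ^ n = 1)
    (hζ1 : ζ ≠ 1) (N : ℕ) : SpecializesTo φ (q ^ N * qInteger q n ^ 2) 0 := by
  have hzero : qInteger ζ n = 0 := by rw [qInteger_eq_div hζ1, hζ, sub_self, zero_div]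
  simpa only [hzero, zero_pow two_ne_zero, mul_zero] using
    (hq.pow N).mul ((hq.qInteger n).pow 2)

end Specializations

section Polynomials

open Polynomial

theorem ratFunc_injective_X_pow (L : Type*) [Field L] :
    Function.Injective ((RatFunc.X : RatFunc L) ^ · : ℕ → RatFunc L) := fun i j hij => by
  simp only [← RatFunc.algebraMap_X, ← map_pow] at hij
  simpa using congrArg natDegree (RatFunc.algebraMap_injective L hij)

theorem cyclotomic_dvd_of_aeval_eq_zero {L : Type*} [Field L] [CharZero L] {ζ : L} {d : ℕ}
    (hζ : IsPrimitiveRoot ζ d) (hd : 0 < d) {f : ℚ[X]} (hf : aeval ζ f = 0) :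
    cyclotomic d ℚ ∣ f := by
  rw [cyclotomic_eq_minpoly_rat hζ hd]
  exact minpoly.dvd ℚ ζ hf

theorem qInteger_X_eq_prod_cyclotomic {n : ℕ} (hn : 0 < n) (R : Type*) [CommRing R] :
    qInteger (X : R[X]) n = ∏ d ∈ n.divisors.erase 1, cyclotomic d R :=
  (prod_cyclotomic_eq_geom_sum hn R).symm

theorem isPrimitive_one_sub_C_mul_X {A : Type*} [CommRing A] (r : A) :
    (1 - C r * X).IsPrimitive := fun s hs => by
  have hcoeff := (C_dvd_iff_dvd_coeff _ _).1 hs 0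
  exact isUnit_of_dvd_one (by simpa using hcoeff)

theorem isRelPrime_C_of_isPrimitive {A : Type*} [CommRing A] [IsDomain A] {g : A} (hg : g ≠ 0)
    {f : A[X]} (hf : f.IsPrimitive) : IsRelPrime (C g) f := fun d hdg hdf => by
  have hdeg : d.natDegree = 0 := by
    simpa using natDegree_le_of_dvd hdg (C_ne_zero.2 hg)
  rw [eq_C_of_natDegree_eq_zero hdeg] at hdf ⊢
  exact isUnit_C.2 (hf _ hdf)

theorem isRelPrime_one_sub_C_mul_X_X_sub_C {A : Type*} [CommRing A] [IsDomain A] {r : A}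
    (hr : r * r ≠ 1) : IsRelPrime (1 - C r * X) (X - C r) := by
  refine IsRelPrime.symm ?_
  rw [(prime_X_sub_C r).irreducible.isRelPrime_iff_not_dvd, dvd_iff_isRoot, IsRoot.def]
  simpa [sub_eq_zero] using hr.symm

theorem one_sub_C_mul_X_dvd_of_eval₂_inv_eq_zero {A K : Type*} [CommRing A] [Field K] {i : A →+* K}
    (hi : Function.Injective i) {r : A} (hr : r ≠ 0) {f : A[X]} (hf : f.eval₂ i (i r)⁻¹ = 0) :
    1 - C r * X ∣ f := by
  have hir : i r ≠ 0 := (map_ne_zero_iff i hi).2 hr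
  have : IsLocalization.Away r (AdjoinRoot (C r * X - 1)) := IsLocalization.adjoin_inv r
  let toField : AdjoinRoot (C r * X - 1) →+* K :=
    AdjoinRoot.lift i (i r)⁻¹ (by simp [hir])
  obtain ⟨k, b, hb⟩ := IsLocalization.Away.surj r (AdjoinRoot.mk (C r * X - 1) f)
  have hb0 : b = 0 := hi <| by
    simpa [toField, hf, AdjoinRoot.algebraMap_eq] using (congrArg toField hb).symm
  rw [hb0, map_zero] at hb
  have hmk : AdjoinRoot.mk (C r * X - 1) f = 0 :=
    ((IsLocalization.Away.algebraMap_isUnit r).pow k).mul_left_eq_zero.1 hb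
  rwa [AdjoinRoot.mk_eq_zero, ← neg_dvd, neg_sub] at hmk

end Polynomials

section ParametricCongruence

open Polynomial

/-- The congruence of part (ii) for `n = 2 * m + 1`, but modulo an arbitrary polynomial `M`, so that
the factors of the modulus can be treated one at a time. -/
def ParamCongr (m : ℕ) (M : PolyQA) : Prop :=
  FracCongr M
    (truncSquare (cTermParam (algebraMap PolyQA RatQA varA) (algebraMap PolyQA RatQA varQ))
      (2 * m + 1))
    (algebraMap PolyQA RatQA varQ ^ (2 * m ^ 2) *
      qInteger (algebraMap PolyQA RatQA varQ) (2 * m + 1) ^ 2)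

theorem qInteger_varQ (n : ℕ) : qInteger varQ n = C (qInteger X n) :=
  (map_qInteger C X n).symm

theorem algebraMap_varQ_pow_succ_ne_one (i : ℕ) : algebraMap PolyQA RatQA varQ ^ (i + 1) ≠ 1 := by
  have hq := SpecializesTo.algebraMap (K := RatQA)
    ((algebraMap ℚ[X] (RatFunc ℚ)).comp (evalRingHom 0)) varQ
  refine hq.pow_ne_one ?_
  simpa [varQ] using pow_succ_ne_one_of_injective_pow (ratFunc_injective_X_pow ℚ) i

theorem paramCongr_varA_sub_varQ_pow (m : ℕ) : ParamCongr m (varA - varQ ^ (2 * m + 1)) := by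
  let φ : PolyQA →+* RatFunc ℚ :=
    (algebraMap ℚ[X] (RatFunc ℚ)).comp (evalRingHom (X ^ (2 * m + 1)))
  have hq : SpecializesTo φ (algebraMap PolyQA RatQA varQ) RatFunc.X := by
    simpa [φ, varQ] using SpecializesTo.algebraMap (K := RatQA) φ varQ
  have ha : SpecializesTo φ (algebraMap PolyQA RatQA varA) (RatFunc.X ^ (2 * m + 1)) := by
    simpa [φ, varA] using SpecializesTo.algebraMap (K := RatQA) φ varA
  refine fracCongr_of_specializesTo (φ := φ) (fun r hr => ?_)
    (specializesTo_truncSquare_cTermParam_pow (ratFunc_injective_X_pow ℚ) hq ha)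
    ((hq.pow _).mul ((hq.qInteger _).pow 2))
  rw [varA, varQ, ← map_pow, dvd_iff_isRoot]
  exact (map_eq_zero_iff _ (RatFunc.algebraMap_injective ℚ)).1 hr

theorem paramCongr_one_sub_varA_mul_varQ_pow (m : ℕ) :
    ParamCongr m (1 - varA * varQ ^ (2 * m + 1)) := by
  let φ : PolyQA →+* RatFunc ℚ :=
    eval₂RingHom (algebraMap ℚ[X] (RatFunc ℚ)) (algebraMap ℚ[X] (RatFunc ℚ) (X ^ (2 * m + 1)))⁻¹
  have hq : SpecializesTo φ (algebraMap PolyQA RatQA varQ) RatFunc.X := by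
    simpa [φ, varQ] using SpecializesTo.algebraMap (K := RatQA) φ varQ
  have ha : SpecializesTo φ (algebraMap PolyQA RatQA varA)⁻¹ (RatFunc.X ^ (2 * m + 1)) := by
    simpa [φ, varA] using (SpecializesTo.algebraMap (K := RatQA) φ varA).inv
      (by simp [φ, varA, RatFunc.X_ne_zero])
  refine fracCongr_of_specializesTo (φ := φ) (fun r hr => ?_)
    (cTermParam_inv _ (algebraMap PolyQA RatQA varQ) ▸
      specializesTo_truncSquare_cTermParam_pow (ratFunc_injective_X_pow ℚ) hq ha)
    ((hq.pow _).mul ((hq.qInteger _).pow 2))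
  rw [varA, varQ, ← map_pow, mul_comm]
  exact one_sub_C_mul_X_dvd_of_eval₂_inv_eq_zero (RatFunc.algebraMap_injective ℚ)
    (pow_ne_zero _ X_ne_zero) hr

theorem ratFunc_X_mul_C_ne_one {L : Type*} [Field L] (c : L) :
    (RatFunc.X : RatFunc L) * RatFunc.C c ≠ 1 := fun h =>
  ratFunc_X_pow_ne_C one_ne_zero c⁻¹ <| by
    rw [pow_one, map_inv₀]
    exact eq_inv_of_mul_eq_one_left h

theorem ratFunc_inv_X_mul_C_ne_one {L : Type*} [Field L] (c : L) :
    (RatFunc.X : RatFunc L)⁻¹ * RatFunc.C c ≠ 1 := fun h =>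
  ratFunc_X_pow_ne_C one_ne_zero c <| by
    rw [pow_one, ← mul_one RatFunc.X, ← h, mul_inv_cancel_left₀ RatFunc.X_ne_zero]

theorem paramCongr_C_cyclotomic {m d : ℕ} (hd : d ∣ 2 * m + 1) (hd1 : d ≠ 1) :
    ParamCongr m (C (cyclotomic d ℚ)) := by
  have hd0 : d ≠ 0 := by rintro rfl; simp at hd
  have hodd : Odd d := Odd.of_dvd_nat ⟨m, rfl⟩ hd
  obtain ⟨ζ, hζ⟩ : ∃ ζ : ℂ, IsPrimitiveRoot ζ d := ⟨_, Complex.isPrimitiveRoot_exp d hd0⟩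
  have hCζ : IsPrimitiveRoot (RatFunc.C ζ) d := hζ.map_of_injective RatFunc.C_injective
  let φ : PolyQA →+* RatFunc ℂ :=
    (algebraMap ℂ[X] (RatFunc ℂ)).comp (mapRingHom (aeval ζ : ℚ[X] →ₐ[ℚ] ℂ).toRingHom)
  have hq : SpecializesTo φ (algebraMap PolyQA RatQA varQ) (RatFunc.C ζ) := by
    simpa [φ, varQ] using SpecializesTo.algebraMap (K := RatQA) φ varQ
  have ha : SpecializesTo φ (algebraMap PolyQA RatQA varA) RatFunc.X := by
    simpa [φ, varA] using SpecializesTo.algebraMap (K := RatQA) φ varA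
  have h (i : ℕ) : (RatFunc.X : RatFunc ℂ) * RatFunc.C ζ ^ (i + 1) ≠ 1 := by
    rw [← map_pow]; exact ratFunc_X_mul_C_ne_one _
  have hinv (i : ℕ) : (RatFunc.X : RatFunc ℂ)⁻¹ * RatFunc.C ζ ^ (i + 1) ≠ 1 := by
    rw [← map_pow]; exact ratFunc_inv_X_mul_C_ne_one _
  refine fracCongr_of_specializesTo (φ := φ) (fun r hr => ?_)
    (specializesTo_truncSquare_cTermParam_zero hCζ hodd hd1 hd RatFunc.X_ne_zero hq
      algebraMap_varQ_pow_succ_ne_one ha (fun k => ⟨_, ha.shiftedRatio hq fun i _ => h i⟩)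
      (fun k => ⟨_, (ha.inv RatFunc.X_ne_zero).shiftedRatio hq fun i _ => hinv i⟩)
      (fun i _ => h i) fun i _ => hinv i)
    (specializesTo_pow_mul_qInteger_sq_zero hq ((hCζ.pow_eq_one_iff_dvd _).2 hd)
      (fun h1 => hd1 (hCζ.unique (h1 ▸ IsPrimitiveRoot.one))) _)
  have hmap := (map_eq_zero_iff _ (RatFunc.algebraMap_injective ℂ)).1 hr
  refine (C_dvd_iff_dvd_coeff _ _).2 fun i =>
    cyclotomic_dvd_of_aeval_eq_zero hζ (Nat.pos_of_ne_zero hd0) ?_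
  simpa using congrArg (coeff · i) hmap

theorem paramCongr_qInteger_varQ (m : ℕ) : ParamCongr m (qInteger varQ (2 * m + 1)) := by
  rw [qInteger_varQ, qInteger_X_eq_prod_cyclotomic (2 * m).succ_pos, map_prod]
  refine fracCongr_prod (fun d _ e _ hde => ((cyclotomic.isCoprime_rat hde).map C).isRelPrime)
    fun d hd => ?_
  rw [Finset.mem_erase, Nat.mem_divisors] at hd
  exact paramCongr_C_cyclotomic hd.2.1 hd.1

theorem paramCongr_prod (m : ℕ) : ParamCongr m
    (qInteger varQ (2 * m + 1) *
      ((1 - varA * varQ ^ (2 * m + 1)) * (varA - varQ ^ (2 * m + 1)))) := by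
  have hprim : IsRelPrime (1 - varA * varQ ^ (2 * m + 1)) (varA - varQ ^ (2 * m + 1)) := by
    rw [varA, varQ, ← map_pow, mul_comm]
    refine isRelPrime_one_sub_C_mul_X_X_sub_C fun h => ?_
    rw [← pow_add] at h
    simpa using congrArg natDegree h
  have hq0 : qInteger (X : ℚ[X]) (2 * m + 1) ≠ 0 := by
    rw [qInteger_X_eq_prod_cyclotomic (2 * m).succ_pos]
    exact Finset.prod_ne_zero_iff.2 fun d _ => cyclotomic_ne_zero d ℚ
  refine (paramCongr_qInteger_varQ m).mul
    ((paramCongr_one_sub_varA_mul_varQ_pow m).mul (paramCongr_varA_sub_varQ_pow m) hprim) ?_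
  rw [qInteger_varQ, varA, varQ, ← map_pow, mul_comm X]
  exact (isRelPrime_C_of_isPrimitive hq0 (isPrimitive_one_sub_C_mul_X _)).mul_right
    (isRelPrime_C_of_isPrimitive hq0 (monic_X_sub_C _).isPrimitive)

end ParametricCongruence

section SquareCongruence

open Polynomial

theorem ratFunc_X_pow_succ_ne_one (i : ℕ) : (RatFunc.X : RatFunc ℚ) ^ (i + 1) ≠ 1 :=
  pow_succ_ne_one_of_injective_pow (ratFunc_injective_X_pow ℚ) i

theorem fracCongr_cyclotomic {n d : ℕ} (hn : Odd n) (hd : d ∣ n) (hd1 : d ≠ 1) (N : ℕ) :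
    FracCongr (cyclotomic d ℚ) (truncSquare (cTerm (RatFunc.X : RatFunc ℚ)) n)
      (RatFunc.X ^ N * qInteger RatFunc.X n ^ 2) := by
  have hd0 : 0 < d := Nat.pos_of_dvd_of_pos hd hn.pos
  have hodd : Odd d := Odd.of_dvd_nat hn hd
  obtain ⟨ζ, hζ⟩ : ∃ ζ : ℂ, IsPrimitiveRoot ζ d := ⟨_, Complex.isPrimitiveRoot_exp d hd0.ne'⟩
  let φ : ℚ[X] →+* ℂ := (aeval ζ : ℚ[X] →ₐ[ℚ] ℂ).toRingHom
  have hq : SpecializesTo φ (RatFunc.X : RatFunc ℚ) ζ := by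
    simpa [φ] using SpecializesTo.algebraMap (K := RatFunc ℚ) φ X
  have hstart := exists_specializesTo_shiftedRatio_one hq ratFunc_X_pow_succ_ne_one
    fun i => pow_ne_neg_one_of_odd hζ.pow_eq_one hodd (i + 1)
  have hpow (i : ℕ) (hi : i + 1 < d) : 1 * ζ ^ (i + 1) ≠ 1 := by
    rw [one_mul]; exact hζ.pow_ne_one_of_pos_of_lt i.succ_ne_zero hi
  rw [cTerm_eq_cTermParam_one]
  refine fracCongr_of_specializesTo (φ := φ)
    (fun r hr => cyclotomic_dvd_of_aeval_eq_zero hζ hd0 hr)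
    (specializesTo_truncSquare_cTermParam_zero hζ hodd hd1 hd one_ne_zero hq
      ratFunc_X_pow_succ_ne_one SpecializesTo.one hstart (by rwa [inv_one])
      hpow (by rwa [inv_one]))
    (specializesTo_pow_mul_qInteger_sq_zero hq ((hζ.pow_eq_one_iff_dvd _).2 hd)
      (fun h1 => hd1 (hζ.unique (h1 ▸ IsPrimitiveRoot.one))) N)

theorem cyclotomic_dvd_qInteger_X {n : ℕ} (hn : 1 < n) :
    cyclotomic n ℚ ∣ qInteger (X : ℚ[X]) n := by
  rw [qInteger_X_eq_prod_cyclotomic (by omega)]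
  exact Finset.dvd_prod_of_mem _ <|
    Finset.mem_erase.2 ⟨hn.ne', Nat.mem_divisors_self n (by omega)⟩

theorem cyclotomic_dvd_one_sub_X_pow (n : ℕ) : cyclotomic n ℚ ∣ 1 - X ^ n := by
  rw [← neg_sub, dvd_neg]
  exact cyclotomic.dvd_X_pow_sub_one n ℚ

theorem isRelPrime_cyclotomic_of_aeval_ne_zero {L : Type*} [Field L] [CharZero L] {ζ : L} {n : ℕ}
    (hζ : IsPrimitiveRoot ζ n) (hn : 0 < n) {f : ℚ[X]} (hf : aeval ζ f ≠ 0) :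
    IsRelPrime f (cyclotomic n ℚ) := by
  refine IsRelPrime.symm ?_
  rw [(cyclotomic.irreducible_rat hn).isRelPrime_iff_not_dvd, cyclotomic_eq_minpoly_rat hζ hn,
    minpoly.dvd_iff]
  exact hf

/-- The limit `a → 1` of the parametric congruence, whose modulus becomes `[n] (1 - q ^ n) ^ 2`. -/
theorem fracCongr_cyclotomic_pow_three_of_param {m : ℕ} (hm : 0 < m) :
    FracCongr (cyclotomic (2 * m + 1) ℚ ^ 3)
      (truncSquare (cTerm (RatFunc.X : RatFunc ℚ)) (2 * m + 1))
      (RatFunc.X ^ (2 * m ^ 2) * qInteger RatFunc.X (2 * m + 1) ^ 2) := by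
  obtain ⟨ζ, hζ⟩ : ∃ ζ : ℂ, IsPrimitiveRoot ζ (2 * m + 1) :=
    ⟨_, Complex.isPrimitiveRoot_exp _ (2 * m).succ_ne_zero⟩
  let f : PolyQA →+* ℚ[X] := evalRingHom 1
  let ψ : ℚ[X] →+* ℂ := (aeval ζ : ℚ[X] →ₐ[ℚ] ℂ).toRingHom
  have hq {L : Type} [Field L] (χ : ℚ[X] →+* L) :
      SpecializesTo (χ.comp f) (algebraMap PolyQA RatQA varQ) (χ X) := by
    simpa [f, varQ] using SpecializesTo.algebraMap (K := RatQA) (χ.comp f) varQ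
  have ha {L : Type} [Field L] (χ : ℚ[X] →+* L) :
      SpecializesTo (χ.comp f) (algebraMap PolyQA RatQA varA) 1 := by
    simpa [f, varA] using SpecializesTo.algebraMap (K := RatQA) (χ.comp f) varA
  have hqX := RatFunc.algebraMap_X (K := ℚ) ▸ hq (algebraMap ℚ[X] (RatFunc ℚ))
  have hqζ : SpecializesTo (ψ.comp f) (algebraMap PolyQA RatQA varQ) ζ := aeval_X (R := ℚ) ζ ▸ hq ψ
  refine FracCongr.specialize (f := f) (ψ := ψ) (paramCongr_prod m)
    (specializesTo_truncSquare_cTermParam_one hqX (ha _) fun i _ => ratFunc_X_pow_succ_ne_one i)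
    ((hqX.pow _).mul ((hqX.qInteger _).pow 2))
    ((specializesTo_truncSquare_cTermParam_one hqζ (ha ψ) fun i hi =>
      hζ.pow_ne_one_of_pos_of_lt i.succ_ne_zero hi).sub
        ((hqζ.pow _).mul ((hqζ.qInteger _).pow 2))) ?_
    fun s hs => (isRelPrime_cyclotomic_of_aeval_ne_zero hζ (2 * m).succ_pos hs).pow_right
  have hmodulus : f (qInteger varQ (2 * m + 1) *
      ((1 - varA * varQ ^ (2 * m + 1)) * (varA - varQ ^ (2 * m + 1)))) =
        qInteger X (2 * m + 1) * ((1 - X ^ (2 * m + 1)) * (1 - X ^ (2 * m + 1))) := by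
    simp only [f, map_mul, map_sub, map_one, map_pow, map_qInteger, varA, varQ, coe_evalRingHom,
      eval_X, eval_C, one_mul]
  rw [hmodulus, pow_succ', sq]
  exact mul_dvd_mul (cyclotomic_dvd_qInteger_X (by omega))
    (mul_dvd_mul (cyclotomic_dvd_one_sub_X_pow _) (cyclotomic_dvd_one_sub_X_pow _))

theorem cyclotomic_pow_three_dvd_sub {n : ℕ} (hn : 1 < n) (N k : ℕ) :
    cyclotomic n ℚ ^ 3 ∣
      X ^ (N + n * k) * qInteger X n ^ 2 - X ^ N * qInteger X n ^ 2 := by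
  have hpow : cyclotomic n ℚ ∣ X ^ (n * k) - 1 :=
    (cyclotomic.dvd_X_pow_sub_one n ℚ).trans (pow_one_sub_dvd_pow_mul_sub_one X n k)
  rw [pow_add, mul_assoc, ← mul_sub, ← sub_one_mul, pow_succ']
  exact (mul_dvd_mul hpow (pow_dvd_pow_of_dvd (cyclotomic_dvd_qInteger_X hn) 2)).mul_left _

theorem fracCongr_cyclotomic_pow_three {m : ℕ} (hm : 0 < m) :
    FracCongr (cyclotomic (2 * m + 1) ℚ ^ 3)
      (truncSquare (cTerm (RatFunc.X : RatFunc ℚ)) (2 * m + 1))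
      (RatFunc.X ^ (m + 1) * qInteger RatFunc.X (2 * m + 1) ^ 2) := by
  refine (fracCongr_cyclotomic_pow_three_of_param hm).trans ?_
  have hexp : 2 * m ^ 2 = m + 1 + (2 * m + 1) * (m - 1) := by
    obtain ⟨k, rfl⟩ := Nat.exists_eq_succ_of_ne_zero hm.ne'
    simp only [Nat.succ_eq_add_one, Nat.add_sub_cancel]
    ring
  rw [hexp]
  simpa only [map_mul, map_pow, map_qInteger, RatFunc.algebraMap_X] using
    fracCongr_algebraMap_of_dvd_sub (K := RatFunc ℚ)
      (cyclotomic_pow_three_dvd_sub (by omega : 1 < 2 * m + 1) (m + 1) (m - 1))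

theorem fracCongr_qInteger_mul_cyclotomic_sq {m : ℕ} (hm : 0 < m) :
    FracCongr (qInteger (X : ℚ[X]) (2 * m + 1) * cyclotomic (2 * m + 1) ℚ ^ 2)
      (truncSquare (cTerm (RatFunc.X : RatFunc ℚ)) (2 * m + 1))
      (RatFunc.X ^ (m + 1) * qInteger RatFunc.X (2 * m + 1) ^ 2) := by
  have hmem : 2 * m + 1 ∈ (2 * m + 1).divisors.erase 1 :=
    Finset.mem_erase.2 ⟨by omega, Nat.mem_divisors_self _ (2 * m).succ_ne_zero⟩
  have hrelprime {d e : ℕ} (h : d ≠ e) : IsRelPrime (cyclotomic d ℚ) (cyclotomic e ℚ) :=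
    (cyclotomic.isCoprime_rat h).isRelPrime
  rw [qInteger_X_eq_prod_cyclotomic (2 * m).succ_pos, ← Finset.mul_prod_erase _ _ hmem,
    mul_right_comm, ← pow_succ', mul_comm]
  refine FracCongr.mul (fracCongr_prod (fun d _ e _ => hrelprime) fun d hd => ?_)
    (fracCongr_cyclotomic_pow_three hm)
    (IsRelPrime.prod_left fun d hd => (hrelprime (Finset.ne_of_mem_erase hd)).pow_right)
  have hdvd := (Finset.mem_erase.1 (Finset.mem_of_mem_erase hd))
  exact fracCongr_cyclotomic ⟨m, rfl⟩ (Nat.dvd_of_mem_divisors hdvd.2) hdvd.1 _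

end SquareCongruence

theorem theorem2 (n : ℕ) (hn : Odd n) :
    (1 < n →
      FracCongr (qInteger (Polynomial.X : Polynomial ℚ) n * Polynomial.cyclotomic n ℚ ^ 2)
        (truncSquare (cTerm (RatFunc.X : RatFunc ℚ)) n)
        ((RatFunc.X : RatFunc ℚ) ^ ((n + 1) / 2) * qInteger (RatFunc.X : RatFunc ℚ) n ^ 2)) ∧
    FracCongr (qInteger varQ n * ((1 - varA * varQ ^ n) * (varA - varQ ^ n)))
      (truncSquare (cTermParam (algebraMap PolyQA RatQA varA) (algebraMap PolyQA RatQA varQ)) n)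
      (algebraMap PolyQA RatQA varQ ^ ((n - 1) ^ 2 / 2) *
        qInteger (algebraMap PolyQA RatQA varQ) n ^ 2) := by
  obtain ⟨m, rfl⟩ := hn
  have hhalf : (2 * m + 1 + 1) / 2 = m + 1 := by omega
  have hexp : (2 * m + 1 - 1) ^ 2 / 2 = 2 * m ^ 2 := by
    rw [Nat.add_sub_cancel, show (2 * m) ^ 2 = 2 * m ^ 2 * 2 by ring]
    exact Nat.mul_div_cancel _ two_pos
  rw [hhalf, hexp]
  exact ⟨fun h => fracCongr_qInteger_mul_cyclotomic_sq (by omega), paramCongr_prod m⟩
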